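/- Let $\Lambda$ be a finite set of edge labels, each with an arity in $\mathbb{N}$. A hypergraph $G$ has a finite set of nodes $V_G$ and a finite set of edges $E_G$; each edge $e$ has a label in $\Lambda$ and a connection sequence $c_G(e)\in V_G^*$ whose length is the arity of its label, and $e$ is incident to the nodes occurring in $c_G(e)$. Directed edge-labelled graphs are the hypergraphs all of whose edges have connection sequences of length two (if all arities are $2$, then all hypergraphs are of this kind). A partial morphism $G\rightharpoonup H$ is a pair of partial functions $V_G\rightharpoonup V_H$, $E_G\rightharpoonup E_H$ which, whenever it is defined on an edge, is defined on all incident nodes and preserves the label and the connection sequence of that edge. A graph transformation system (GTS) is a finite set of rules, a rule being a partial morphism $r\colon L\rightharpoonup R$. Write $G\Rightarrow H$ if there are a rule $r\colon L\rightharpoonup R$ of the GTS and a total morphism $m\colon L\to G$ that is conflict-free (if $m(x)=m(y)$, then $r(x),r(y)$ are both defined or both undefined) such that $H$, together with some morphisms $R\rightharpoonup H$ and $G\rightharpoonup H$, is a pushout of $r$ and $m$ in the category of hypergraphs and partial morphisms. Write $G_1\sqsubseteq G_2$ (induced subgraph ordering) if $G_1$ is isomorphic to a hypergraph obtained from $G_2$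 by deleting a subset of the nodes together with all edges incident to them. An (elementary) undirected path of length $\ell$ is a sequence $v_0,e_1,v_1,\dots,e_\ell,v_\ell$ of pairwise distinct nodes and pairwise distinct edges such that $e_i$ is incident to both $v_{i-1}$ and $v_i$. For $n,k\in\mathbb{N}$ let $\mathcal{G}_{n,k}$ be the set of directed edge-labelled graphs in which every undirected path has length at most $n$ and in which, for every label $a$ and all nodes $x,y$ (possibly $x=y$), there are at most $k$ edges $e$ with label $a$ and $c(e)=xy$. Then for all $n,k\in\mathbb{N}$ and every GTS, the transition system $\Rightarrow$ on the set of all hypergraphs, ordered by $\sqsubseteq$, is a $\mathcal{G}_{n,k}$-restricted well-structured transition system, that is: 1. $\mathcal{G}_{n,k}$ is downward closed with respect to $\sqsubseteq$. 2. Membership in $\mathcal{G}_{n,k}$ is decidable. In detail, fix an injective numbering of the labels by natural numbers. Every hypergraph can be described (after numbering its nodes and its edges) by its number of nodes and the list of the connection sequences and label numbers of its edges, and there is a computable predicate on such descriptions that tells, for every description of a hypergraph, whether that hypergraph belongs to $\mathcal{G}_{n,k}$. 3. $\sqsubseteq$ is a quasi-order (reflexive and transitive) on all hypergraphs, and a well-quasi-order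 on $\mathcal{G}_{n,k}$: for every infinite sequence $G_0,G_1,\dots$ in $\mathcal{G}_{n,k}$ there are $i<j$ with $G_i\sqsubseteq G_j$. 4. (Compatibility) If $G_1\sqsubseteq G_1'$ and $G_1\Rightarrow G_2$, then there is $G_2'$ with $G_1'\Rightarrow^* G_2'$ and $G_2\sqsubseteq G_2'$. -/

import Mathlib

universe u v w

/-- A finite `Λ`-hypergraph, where `ar` gives the arity of each edge label: every edge is attached
to a sequence of nodes whose length is the arity of the label of the edge. Directed edge-labelled
(multi)graphs are the hypergraphs all of whose edges are attached to exactly two nodes. -/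
structure LHypergraph {Λ : Type v} (ar : Λ → ℕ) where
  V : Type u
  E : Type u
  finite_V : Finite V
  finite_E : Finite E
  conn : E → List V
  lab : E → Λ
  length_conn : ∀ e, (conn e).length = ar (lab e)

namespace LHypergraph

variable {Λ : Type v} {ar : Λ → ℕ}

/-- A partial hypergraph morphism. A value `none` means that the morphism is undefined there. The
last condition says both that a morphism which is defined on an edge is defined on all nodes
incident to it, and that it preserves the connection sequence of the edge. -/
@[ext]
structure Mor (G H : LHypergraph.{u} ar) where
  onV : G.V → Option H.V
  onE : G.E → Option H.E
  lab_eq : ∀ e e', onE e = some e' → H.lab e' = G.lab e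
  conn_eq : ∀ e e', onE e = some e' → (G.conn e).map onV = (H.conn e').map some

/-- The composition `g ∘ f` of partial morphisms. -/
def Mor.comp {G H K : LHypergraph.{u} ar} (g : Mor H K) (f : Mor G H) : Mor G K where
  onV v := (f.onV v).bind g.onV
  onE e := (f.onE e).bind g.onE
  lab_eq e e' h := by
    obtain ⟨a, ha, hb⟩ := Option.bind_eq_some_iff.1 h
    rw [g.lab_eq a e' hb, f.lab_eq e a ha]
  conn_eq e e' h := by
    obtain ⟨a, ha, hb⟩ := Option.bind_eq_some_iff.1 h
    have h1 := congrArg (List.map fun o => o.bind g.onV) (f.conn_eq e a ha)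
    rw [List.map_map, List.map_map] at h1
    exact h1.trans (g.conn_eq a e' hb)

/-- A morphism that is defined on all nodes and edges. -/
def Mor.IsTotal {G H : LHypergraph.{u} ar} (f : Mor G H) : Prop :=
  (∀ v, (f.onV v).isSome) ∧ ∀ e, (f.onE e).isSome

/-- An isomorphism of hypergraphs, that is, a total bijective morphism. -/
structure Iso (G H : LHypergraph.{u} ar) where
  onV : G.V ≃ H.V
  onE : G.E ≃ H.E
  lab_eq : ∀ e, H.lab (onE e) = G.lab e
  conn_eq : ∀ e, H.conn (onE e) = (G.conn e).map onV

/-- The square with sides `f : G₀ ⇀ G₁`, `g : G₀ ⇀ G₂`, `g' : G₁ ⇀ G₃`, `f' : G₂ ⇀ G₃` is a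
pushout in the category of hypergraphs and partial morphisms. -/
def IsPushout {G₀ G₁ G₂ G₃ : LHypergraph.{u} ar} (f : Mor G₀ G₁) (g : Mor G₀ G₂)
    (g' : Mor G₁ G₃) (f' : Mor G₂ G₃) : Prop :=
  g'.comp f = f'.comp g ∧
    ∀ (K : LHypergraph.{u} ar) (g'' : Mor G₁ K) (f'' : Mor G₂ K), g''.comp f = f''.comp g →
      ∃! η : Mor G₃ K, η.comp g' = g'' ∧ η.comp f' = f''

/-- A rewriting rule: a partial morphism from a left-hand side to a right-hand side. -/
structure Rule (ar : Λ → ℕ) where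
  L : LHypergraph.{u} ar
  R : LHypergraph.{u} ar
  r : Mor L R

/-- `m` is conflict-free with respect to `r`: if `m` identifies two elements, then `r` is defined
on both of them or on none of them. -/
def ConflictFree {L R G : LHypergraph.{u} ar} (r : Mor L R) (m : Mor L G) : Prop :=
  (∀ x y, m.onV x = m.onV y → ((r.onV x).isSome ↔ (r.onV y).isSome)) ∧
    ∀ x y, m.onE x = m.onE y → ((r.onE x).isSome ↔ (r.onE y).isSome)

/-- `G` can be rewritten to `H` by the rule `ρ` (single-pushout approach, with a total
conflict-free match). -/
def Rule.Rewrites (ρ : Rule.{u} ar) (G H : LHypergraph.{u} ar) : Prop :=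
  ∃ m : Mor ρ.L G, m.IsTotal ∧ ConflictFree ρ.r m ∧
    ∃ (m' : Mor ρ.R H) (r' : Mor G H), IsPushout ρ.r m m' r'

/-- A graph transformation system: a finite set of rewriting rules. -/
structure GTS (ar : Λ → ℕ) where
  rules : Set (Rule.{u} ar)
  finite_rules : rules.Finite

/-- The transition relation on the set of all hypergraphs generated by a graph transformation
system. -/
def GTS.Step (T : GTS.{u} ar) (G H : LHypergraph.{u} ar) : Prop :=
  ∃ ρ ∈ T.rules, ρ.Rewrites G H

/-- The hypergraph obtained by deleting the nodes in `X` and all edges incident to them. -/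
def deleteNodes (G : LHypergraph.{u} ar) (X : Set G.V) : LHypergraph.{u} ar where
  V := {v : G.V // v ∉ X}
  E := {e : G.E // ∀ v ∈ G.conn e, v ∉ X}
  finite_V := haveI := G.finite_V; inferInstance
  finite_E := haveI := G.finite_E; inferInstance
  conn e := (G.conn e.1).attachWith (fun v => v ∉ X) e.2
  lab e := G.lab e.1
  length_conn e := by rw [List.length_attachWith]; exact G.length_conn e.1

/-- The induced subgraph ordering: up to isomorphism, `G` is obtained from `H` by deleting a
subset of the nodes and all incident edges. -/
def InducedSubgraph (G H : LHypergraph.{u} ar) : Prop :=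
  ∃ X : Set H.V, Nonempty (Iso G (H.deleteNodes X))

/-- `v 0, e 0, v 1, …, e (l - 1), v l` is an (elementary) undirected path of length `l`: no node
and no edge occurs twice, and each edge is incident to the node before and to the node after it. -/
def IsUndirectedPath (G : LHypergraph.{u} ar) (l : ℕ) (v : Fin (l + 1) → G.V)
    (e : Fin l → G.E) : Prop :=
  Function.Injective v ∧ Function.Injective e ∧
    ∀ i : Fin l, v i.castSucc ∈ G.conn (e i) ∧ v i.succ ∈ G.conn (e i)

/-- The class of all directed graphs in which undirected paths have length at most `n` and in
which, for every label and all (not necessarily distinct) nodes `x` and `y`, there are at most `k`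
edges with this label from `x` to `y`. -/
def boundedDigraphs (ar : Λ → ℕ) (n k : ℕ) : Set (LHypergraph.{u} ar) :=
  {G | (∀ e, (G.conn e).length = 2) ∧
    (∀ l v e, G.IsUndirectedPath l v e → l ≤ n) ∧
    ∀ (a : Λ) (x y : G.V), {e : G.E | G.lab e = a ∧ G.conn e = [x, y]}.ncard ≤ k}

/-- Finite descriptions of hypergraphs: a number of nodes, and the list of edges, each given by its
connection sequence and a number for its label. -/
abbrev Code : Type := ℕ × List (List ℕ × ℕ)

/-- `c` describes `G`, where `ν` numbers the labels: after numbering the nodes and edges of `G`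
from `0` on, `c` consists of the number of nodes and the list of the edges of `G`. -/
def Encodes (ν : Λ → ℕ) (c : Code) (G : LHypergraph.{u} ar) : Prop :=
  ∃ (f : G.V ≃ Fin c.1) (g : G.E ≃ Fin c.2.length),
    ∀ e, c.2.get (g e) = ((G.conn e).map fun x => (f x : ℕ), ν (G.lab e))

end LHypergraph

/-- Membership in `Q` is decidable, where a description `c` of a state `s` (`rep c s`) is given as
input: every state has a description, and some computable predicate of descriptions tells whether
the described state belongs to `Q`. -/
def DecidableMembership {S : Type w} {C : Type} [Primcodable C] (rep : C → S → Prop)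
    (Q : Set S) : Prop :=
  (∀ s, ∃ c, rep c s) ∧
    ∃ p : C → Prop, ComputablePred p ∧ ∀ c s, rep c s → (p c ↔ s ∈ Q)

/-- `(S, step, le)` is a `Q`-restricted well-structured transition system. -/
structure IsRestrictedWSTS {S : Type w} {C : Type} [Primcodable C] (rep : C → S → Prop)
    (Q : Set S) (step le : S → S → Prop) : Prop where
  downward_closed : ∀ s t, le s t → t ∈ Q → s ∈ Q
  decidable_mem : DecidableMembership rep Q
  le_refl : ∀ s, le s s
  le_trans : ∀ s t r, le s t → le t r → le s r
  wqo : Q.PartiallyWellOrderedOn le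
  compatible : ∀ s₁ t₁ s₂, le s₁ t₁ → step s₁ s₂ →
    ∃ t₂, Relation.ReflTransGen step t₁ t₂ ∧ le s₂ t₂

/-! The well-quasi-order comes from bounded tree-depth. In a connected part, delete a node `v` at
which only paths with at most `n + 1` nodes start: each remaining component contains a neighbour of
`v`, at which only paths with at most `n` nodes start. Hence boundedly many rounds of deleting one
node per component exhaust the graph (`RootedBound.layered`). By induction on the number of rounds,
such graphs are well-quasi-ordered: the edges between a component and its deleted root are recorded
in node labels, which still come from a finite set because multiplicities are at most `k`; the
induction hypothesis handles each labelled remainder, and Higman's lemma the list of components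
(`LabelledSet.partiallyWellOrderedOn_layered`).

Compatibility needs a single step. A match into an induced subgraph is also a match into the larger
graph and stays conflict-free, so an explicit gluing provides a pushout there
(`isPushout_pushoutObj`). Deleting the images of the additional nodes from it leaves a pushout over
the smaller graph (`IsInduced.exists_isPushout`), and pushouts are unique up to isomorphism.

Membership is decidable because both bounds can be tested by quantifiers ranging over the edge list,
nested to a depth that depends only on `n`. -/

/-! ### Bounded paths and bounded tree-depth. -/

/-- Every path which starts at `x`, stays in `S` and uses the adjacency relation `adj` has at most
`m` nodes. -/
def PathBound {V : Type u} (adj : V → V → Prop) : ℕ → Set V → V → Prop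
  | 0, _, _ => False
  | m + 1, S, x => ∀ y ∈ S, y ≠ x → adj x y → PathBound adj m (S \ {x}) y

theorem PathBound.mono {V : Type u} {adj adj' : V → V → Prop} (h : ∀ x y, adj' x y → adj x y) :
    ∀ {m : ℕ} {S S' : Set V} {x : V}, S' ⊆ S → PathBound adj m S x → PathBound adj' m S' x
  | 0, _, _, _, _, hb => hb
  | _ + 1, _, _, _, hS, hb => fun y hy hne hxy =>
    PathBound.mono h (Set.sdiff_subset_sdiff_left hS) (hb y (hS hy) hne (h _ _ hxy))

/-- The list `L` decomposes `S` into pairwise non-adjacent parts `insert p.1 p.2`, each with a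
distinguished node `p.1`, such that the remainders `p.2` satisfy `P`. -/
inductive Decomposes {V : Type u} (adj : V → V → Prop) (P : Set V → Prop) :
    List (V × Set V) → Set V → Prop
  | nil : Decomposes adj P [] ∅
  | cons {v : V} {D S : Set V} {L : List (V × Set V)} : v ∉ D → P D → Decomposes adj P L S →
      Disjoint (insert v D) S → (∀ x ∈ insert v D, ∀ y ∈ S, ¬ adj x y) →
      Decomposes adj P ((v, D) :: L) (insert v D ∪ S)

/-- `S` can be exhausted in `n` rounds, each of which removes one node from every part. -/
def Layered {V : Type u} (adj : V → V → Prop) : ℕ → Set V → Prop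
  | 0, S => S = ∅
  | n + 1, S => ∃ L, Decomposes adj (Layered adj n) L S

/-- Every node of `S` is connected within `S` to a node at which only paths with at most `n` nodes
start. -/
def RootedBound {V : Type u} (adj : V → V → Prop) (n : ℕ) (S : Set V) : Prop :=
  ∀ x ∈ S, ∃ v ∈ S, Relation.ReflTransGen (fun a b => a ∈ S ∧ b ∈ S ∧ adj a b) x v ∧
    PathBound adj n S v

/-- Only one good root per component is demanded, since this is what survives deleting a root: its
neighbours get a smaller bound, whereas paths starting elsewhere need not become shorter. The outer
induction is on the number of rounds, the inner one on the size of `S`, splitting off one component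
at a time. -/
theorem RootedBound.layered {V : Type u} {adj : V → V → Prop} (hsymm : ∀ x y, adj x y → adj y x)
    (n : ℕ) : ∀ (S : Set V), S.Finite → RootedBound adj n S → Layered adj n S := by
  induction n with
  | zero =>
    intro S _ h
    refine Set.eq_empty_iff_forall_notMem.2 fun x hx => ?_
    obtain ⟨v, -, -, hv⟩ := h x hx
    exact hv
  | succ n ih =>
    intro S hS
    induction hk : S.ncard using Nat.strong_induction_on generalizing S with
    | _ k ihk =>
    intro h
    rcases S.eq_empty_or_nonempty with rfl | ⟨x, hx⟩
    · exact ⟨[], .nil⟩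
    obtain ⟨v, hvS, -, hv⟩ := h x hx
    -- The connected component of `v` in `S`.
    set C : Set V := {y | y ∈ S ∧
      Relation.ReflTransGen (fun a b => a ∈ S ∧ b ∈ S ∧ adj a b) y v} with hC
    have hCS : C ⊆ S := fun y hy => hy.1
    have hvC : v ∈ C := ⟨hvS, .refl⟩
    have hclosed : ∀ y ∈ C, ∀ z ∈ S, adj z y → z ∈ C := fun y hy z hz hzy =>
      ⟨hz, Relation.ReflTransGen.head ⟨hz, hy.1, hzy⟩ hy.2⟩
    have hD : Layered adj n (C \ {v}) := by
      refine ih _ (hS.subset (Set.sdiff_subset.trans hCS)) ?_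
      rintro y ⟨hyC, hyv⟩
      -- The new root `w` is the node just before the first visit to `v` on a walk from `y` to `v`.
      have key : ∀ y, Relation.ReflTransGen (fun a b => a ∈ S ∧ b ∈ S ∧ adj a b) y v → y ≠ v →
          y ∈ S → ∃ w ∈ C \ {v}, adj v w ∧ Relation.ReflTransGen
            (fun a b => a ∈ C \ {v} ∧ b ∈ C \ {v} ∧ adj a b) y w := by
        intro y hy
        induction hy using Relation.ReflTransGen.head_induction_on with
        | refl => exact fun h => absurd rfl h
        | head hac hcv ihc =>
          rename_i a c
          intro hav haS
          have haC : a ∈ C \ {v} := ⟨⟨haS, .head hac hcv⟩, hav⟩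
          by_cases hcv' : c = v
          · subst hcv'
            exact ⟨a, haC, hsymm _ _ hac.2.2, .refl⟩
          · obtain ⟨w, hw, hvw, hcw⟩ := ihc hcv' hac.2.1
            exact ⟨w, hw, hvw, .head ⟨haC, ⟨⟨hac.2.1, hcv⟩, hcv'⟩, hac.2.2⟩ hcw⟩
      obtain ⟨w, hw, hvw, hyw⟩ := key y hyC.2 hyv hyC.1
      exact ⟨w, hw, hyw, (hv w hw.1.1 hw.2 hvw).mono (fun _ _ h => h)
        (Set.sdiff_subset_sdiff_left hCS)⟩
    have hlt : (S \ C).ncard < k := by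
      rw [← hk]
      exact Set.ncard_lt_ncard
        ⟨Set.sdiff_subset, fun hsub => (hsub hvS).2 hvC⟩ hS
    obtain ⟨L, hL⟩ := ihk _ hlt (S \ C) (hS.subset Set.sdiff_subset) rfl (by
      rintro y ⟨hyS, hyC⟩
      obtain ⟨z, hzS, hyz, hz⟩ := h y hyS
      -- A walk that starts outside the component never enters it, so the old root still serves.
      have key : ∀ y, Relation.ReflTransGen (fun a b => a ∈ S ∧ b ∈ S ∧ adj a b) y z →
          y ∉ C → z ∉ C ∧ Relation.ReflTransGen
            (fun a b => a ∈ S \ C ∧ b ∈ S \ C ∧ adj a b) y z := by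
        intro y hy
        induction hy using Relation.ReflTransGen.head_induction_on with
        | refl => exact fun h => ⟨h, .refl⟩
        | head hac hcz ihc =>
          rename_i a c
          intro haC
          have hcC : c ∉ C := fun hc => haC (hclosed c hc a hac.1 hac.2.2)
          exact ⟨(ihc hcC).1, .head ⟨⟨hac.1, haC⟩, ⟨hac.2.1, hcC⟩, hac.2.2⟩ (ihc hcC).2⟩
      obtain ⟨hzC, hr⟩ := key y hyz hyC
      exact ⟨z, ⟨hzS, hzC⟩, hr, hz.mono (fun _ _ h => h) Set.sdiff_subset⟩)
    have hins : insert v (C \ {v}) = C := by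
      rw [Set.insert_sdiff_singleton, Set.insert_eq_of_mem hvC]
    refine ⟨(v, C \ {v}) :: L, ?_⟩
    have := Decomposes.cons (adj := adj) (P := Layered adj n) (v := v) (D := C \ {v})
      (fun h => h.2 rfl) hD hL (by rw [hins]; exact Set.disjoint_sdiff_right)
      (by
        rw [hins]
        intro a ha b hb hab
        exact hb.2 (hclosed a ha b hb.1 (hsymm _ _ hab)))
    rwa [hins, Set.union_sdiff_cancel hCS] at this

/-! ### Well-quasi-ordering of labelled structures of bounded depth. -/

/-- A set of nodes with labels in `A` and a matrix of entries in `B` for pairs of nodes. -/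
structure LabelledSet (A B : Type*) where
  V : Type u
  S : Set V
  entry : V → V → B
  label : V → A

namespace LabelledSet

variable {A : Type v} {B : Type w}

/-- `f` embeds `X` into `Y` as an induced substructure. -/
structure IsEmbedding (X Y : LabelledSet.{u} A B) (f : X.V → Y.V) : Prop where
  mapsTo : Set.MapsTo f X.S Y.S
  injOn : Set.InjOn f X.S
  label_eq : ∀ x ∈ X.S, Y.label (f x) = X.label x
  entry_eq : ∀ x ∈ X.S, ∀ y ∈ X.S, Y.entry (f x) (f y) = X.entry x y

/-- `X` embeds into `Y` as an induced substructure. -/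
def Embeds (X Y : LabelledSet.{u} A B) : Prop := ∃ f, IsEmbedding X Y f

instance : IsPreorder (LabelledSet.{u} A B) Embeds where
  refl _ := ⟨id, Set.mapsTo_id _, Set.injOn_id _, fun _ _ => rfl, fun _ _ _ _ => rfl⟩
  trans _ _ _ := fun ⟨f, hf⟩ ⟨g, hg⟩ =>
    ⟨g ∘ f, hg.mapsTo.comp hf.mapsTo, hg.injOn.comp hf.injOn hf.mapsTo,
      fun x hx => (hg.label_eq _ (hf.mapsTo hx)).trans (hf.label_eq x hx),
      fun x hx y hy =>
        (hg.entry_eq _ (hf.mapsTo hx) _ (hf.mapsTo hy)).trans (hf.entry_eq x hx y hy)⟩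

/-- Two nodes are linked if one of their entries differs from the default value. -/
def Linked (b₀ : B) (X : LabelledSet.{u} A B) (x y : X.V) : Prop :=
  X.entry x y ≠ b₀ ∨ X.entry y x ≠ b₀

/-- The substructure on `p.2`, in which the entries with `p.1` are recorded in the labels, together
with the label and the entry of `p.1`. -/
def part (X : LabelledSet.{u} A B) (p : X.V × Set X.V) :
    (A × B) × LabelledSet.{u} (A × B × B) B :=
  ((X.label p.1, X.entry p.1 p.1),
    ⟨X.V, p.2, X.entry, fun x => (X.label x, X.entry x p.1, X.entry p.1 x)⟩)

/-- Embeddings of matched parts combine into one: inside a part, the labels guarantee the right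
entries with the root, and across parts all entries equal `b₀` on both sides. -/
theorem embeds_of_sublistForall₂ (b₀ : B) (X Y : LabelledSet.{u} A B) [Nonempty Y.V]
    {P : Set X.V → Prop} {Q : Set Y.V → Prop} {M : List (Y.V × Set Y.V)} {T : Set Y.V}
    (hM : Decomposes (Y.Linked b₀) Q M T) :
    ∀ {L : List (X.V × Set X.V)} {S : Set X.V}, Decomposes (X.Linked b₀) P L S →
      List.SublistForall₂ (fun p q => p.1 = q.1 ∧ Embeds p.2 q.2) (L.map X.part) (M.map Y.part) →
      Embeds ⟨X.V, S, X.entry, X.label⟩ ⟨Y.V, T, Y.entry, Y.label⟩ := by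
  classical
  have hnil : ∀ T : Set Y.V, Embeds ⟨X.V, ∅, X.entry, X.label⟩ ⟨Y.V, T, Y.entry, Y.label⟩ :=
    fun T => ⟨fun _ => Classical.arbitrary Y.V, Set.mapsTo_empty _ _, Set.injOn_empty _,
      fun _ h => absurd h (Set.notMem_empty _), fun _ h => absurd h (Set.notMem_empty _)⟩
  induction hM with
  | nil =>
    intro L S hL h
    cases hL with
    | nil => exact hnil _
    | cons => cases h
  | @cons w E T M hw hQ hM hdisj hno ih =>
    intro L S hL h
    cases hL with
    | nil => exact hnil _
    | @cons v D S L hv hP hL hdisj' hno' =>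
      simp only [List.map_cons] at h
      cases h with
      | cons_right h =>
        obtain ⟨f, hf⟩ := ih (.cons hv hP hL hdisj' hno') (by simpa using h)
        exact ⟨f, fun x hx => Or.inr (hf.mapsTo hx), hf.injOn, hf.label_eq, hf.entry_eq⟩
      | cons h₁ h₂ =>
        obtain ⟨g, hg⟩ := ih hL h₂
        obtain ⟨h₀, f, hf⟩ := h₁
        have hvw : X.label v = Y.label w ∧ X.entry v v = Y.entry w w := by
          simpa [part] using h₀
        have hfl : ∀ x ∈ D, Y.label (f x) = X.label x ∧ Y.entry (f x) w = X.entry x v ∧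
            Y.entry w (f x) = X.entry v x := fun x hx => by
          simpa [part] using hf.label_eq x hx
        have hfe : ∀ x ∈ D, ∀ y ∈ D, Y.entry (f x) (f y) = X.entry x y := hf.entry_eq
        have hfm : ∀ x ∈ D, f x ∈ E := hf.mapsTo
        have hfi : Set.InjOn f D := hf.injOn
        have hgm : ∀ x ∈ S, g x ∈ T := hg.mapsTo
        have hgi : Set.InjOn g S := hg.injOn
        have hge : ∀ x ∈ S, ∀ y ∈ S, Y.entry (g x) (g y) = X.entry x y := hg.entry_eq
        -- Root to root, the remainder of the first part by `f`, all other parts by `g`.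
        let F : X.V → Y.V := fun x => if x = v then w else if x ∈ D then f x else g x
        have Fv : F v = w := if_pos rfl
        have FD : ∀ x ∈ D, F x = f x := fun x hx => by
          have : x ≠ v := fun h => hv (h ▸ hx)
          exact (if_neg this).trans (if_pos hx)
        have FS : ∀ x ∈ S, F x = g x := fun x hx => by
          have h₁ : x ∉ insert v D := fun h => Set.disjoint_left.1 hdisj' h hx
          rw [Set.mem_insert_iff, not_or] at h₁
          simp [F, h₁.1, h₁.2]
        have hC : ∀ x ∈ insert v D, F x ∈ insert w E ∧ Y.label (F x) = X.label x ∧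
            ∀ y ∈ insert v D, Y.entry (F x) (F y) = X.entry x y ∧ (F x = F y → x = y) := by
          rintro x (rfl | hx)
          · refine ⟨Or.inl Fv, by rw [Fv, hvw.1], ?_⟩
            rintro y (rfl | hy)
            · exact ⟨by rw [Fv, hvw.2], fun _ => rfl⟩
            · rw [Fv, FD y hy]
              exact ⟨(hfl y hy).2.2, fun h => absurd (h ▸ hfm y hy) hw⟩
          · refine ⟨Or.inr (FD x hx ▸ hfm x hx), by rw [FD x hx, (hfl x hx).1], ?_⟩
            rintro y (rfl | hy)
            · rw [Fv, FD x hx]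
              exact ⟨(hfl x hx).2.1, fun h => absurd (h ▸ hfm x hx) hw⟩
            · rw [FD x hx, FD y hy]
              exact ⟨hfe x hx y hy, fun h => hfi hx hy h⟩
        have hcross : ∀ x ∈ insert v D, ∀ y ∈ S, (Y.entry (F x) (F y) = X.entry x y ∧
            Y.entry (F y) (F x) = X.entry y x) ∧ F x ≠ F y := by
          intro x hx y hy
          have h₁ := hno' x hx y hy
          have hFx := (hC x hx).1
          have hFy : F y ∈ T := FS y hy ▸ hgm y hy
          have h₂ := hno _ hFx _ hFy
          simp only [Linked, not_or, not_not] at h₁ h₂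
          exact ⟨⟨h₂.1.trans h₁.1.symm, h₂.2.trans h₁.2.symm⟩,
            fun h => Set.disjoint_left.1 hdisj hFx (h ▸ hFy)⟩
        refine ⟨F, ?_, ?_, ?_, ?_⟩
        · rintro x (hx | hx)
          · exact Or.inl (hC x hx).1
          · exact Or.inr (FS x hx ▸ hgm x hx)
        · rintro x (hx | hx) y (hy | hy) hxy
          · exact ((hC x hx).2.2 y hy).2 hxy
          · exact absurd hxy (hcross x hx y hy).2
          · exact absurd hxy.symm (hcross y hy x hx).2
          · rw [FS x hx, FS y hy] at hxy
            exact hgi hx hy hxy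
        · rintro x (hx | hx)
          · exact (hC x hx).2.1
          · exact (congrArg Y.label (FS x hx)).trans (hg.label_eq x hx)
        · rintro x (hx | hx) y (hy | hy)
          · exact ((hC x hx).2.2 y hy).1
          · exact (hcross x hx y hy).1.1
          · exact (hcross y hy x hx).1.2
          · change Y.entry (F x) (F y) = X.entry x y
            rw [FS x hx, FS y hy]
            exact hge x hx y hy

theorem _root_.Decomposes.forall_mem {V : Type u} {adj : V → V → Prop} {P : Set V → Prop}
    {L : List (V × Set V)} {S : Set V} (h : Decomposes adj P L S) : ∀ p ∈ L, P p.2 := by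
  induction h with
  | nil => simp
  | cons hv hP _ _ _ ih =>
    rintro p hp
    rcases List.mem_cons.1 hp with rfl | hp
    · exact hP
    · exact ih p hp

/-- The label type is quantified inside the induction because each round enlarges it from `A` to `A
× B × B`. Nonemptiness of the carrier is needed since an embedding is a function on the whole
carrier, even when the distinguished set is empty. -/
theorem partiallyWellOrderedOn_layered {B : Type w} [Finite B] (b₀ : B) (n : ℕ) :
    ∀ (A : Type w) [Finite A],
      {X : LabelledSet.{u} A B | Nonempty X.V ∧ Layered (X.Linked b₀) n X.S}.PartiallyWellOrderedOn
        Embeds := by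
  induction n with
  | zero =>
    intro A _
    rw [Set.partiallyWellOrderedOn_iff_exists_lt]
    intro X hX
    refine ⟨0, 1, one_pos, ?_⟩
    obtain ⟨y⟩ := (hX 1).1
    have h : (X 0).S = ∅ := (hX 0).2
    exact ⟨fun _ => y, by simp [h, Set.MapsTo], by simp [h], by simp [h], by simp [h]⟩
  | succ n ih =>
    intro A _
    rw [Set.partiallyWellOrderedOn_iff_exists_lt]
    intro X hX
    choose L hL using fun i => (hX i).2
    have hfin : (Set.univ : Set (A × B)).PartiallyWellOrderedOn (· = ·) :=
      Set.finite_univ.partiallyWellOrderedOn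
    have hprod := hfin.prod (ih (A × B × B))
    have : IsPreorder ((A × B) × LabelledSet.{u} (A × B × B) B)
        (fun p q => p.1 = q.1 ∧ Embeds p.2 q.2) :=
      { refl := fun p => ⟨rfl, refl p.2⟩
        trans := fun _ _ _ h h' => ⟨h.1.trans h'.1, _root_.trans h.2 h'.2⟩ }
    -- Higman's lemma, applied to the lists of parts.
    obtain ⟨i, j, hij, h⟩ := (hprod.partiallyWellOrderedOn_sublistForall₂
      (fun p q => p.1 = q.1 ∧ Embeds p.2 q.2)).exists_lt
      (f := fun i => (L i).map (X i).part) (by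
        intro i p hp
        obtain ⟨q, hq, rfl⟩ := List.mem_map.1 hp
        exact ⟨Set.mem_univ _, (hX i).1, (hL i).forall_mem q hq⟩)
    have := (hX j).1
    exact ⟨i, j, hij, embeds_of_sublistForall₂ b₀ (X i) (X j) (hL j) (hL i) h⟩

end LabelledSet

/-! ### Recursive path bounds versus explicit paths. -/

theorem exists_path_of_not_pathBound {V : Type u} {adj : V → V → Prop} :
    ∀ {m : ℕ} {S : Set V} {x : V}, x ∈ S → ¬ PathBound adj m S x →
      ∃ p : Fin (m + 1) → V, Function.Injective p ∧ p 0 = x ∧ (∀ i, p i ∈ S) ∧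
        ∀ i : Fin m, adj (p i.castSucc) (p i.succ)
  | 0, S, x, hx, _ => ⟨fun _ => x, fun i j _ => Subsingleton.elim (α := Fin 1) i j, rfl,
      fun _ => hx, fun i => i.elim0⟩
  | m + 1, S, x, hx, h => by
    simp only [PathBound, not_forall] at h
    obtain ⟨y, hy, hyx, hxy, hb⟩ := h
    obtain ⟨p, hp, hp0, hpS, hpa⟩ := exists_path_of_not_pathBound
      (show y ∈ S \ {x} from ⟨hy, hyx⟩) hb
    refine ⟨Fin.cons x p, ?_, rfl, ?_, ?_⟩
    · rw [Fin.cons_injective_iff]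
      exact ⟨fun ⟨i, hi⟩ => (hpS i).2 hi, hp⟩
    · intro i
      cases i using Fin.cases with
      | zero => exact hx
      | succ i => exact (hpS i).1
    · intro i
      cases i using Fin.cases with
      | zero => simpa [hp0] using hxy
      | succ i =>
        rw [← Fin.succ_castSucc, Fin.cons_succ, Fin.cons_succ]
        exact hpa i

theorem PathBound.length_lt {V : Type u} {adj : V → V → Prop} :
    ∀ {m : ℕ} {S : Set V} {l : ℕ} (p : Fin (l + 1) → V), PathBound adj m S (p 0) →
      Function.Injective p → (∀ i, p i ∈ S) → (∀ i : Fin l, adj (p i.castSucc) (p i.succ)) → l < m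
  | 0, _, _, _, h, _, _, _ => h.elim
  | m + 1, _, 0, _, _, _, _, _ => Nat.succ_pos m
  | _ + 1, _, _ + 1, p, h, hp, hS, ha =>
    Nat.succ_lt_succ (PathBound.length_lt (fun i => p i.succ)
      (h _ (hS _) (fun h' => absurd (hp h') (Fin.succ_ne_zero _)) (ha 0))
      (fun _ _ hij => Fin.succ_injective _ (hp hij))
      (fun _ => ⟨hS _, fun h' => absurd (hp h') (Fin.succ_ne_zero _)⟩)
      (fun i => ha i.succ))

namespace LHypergraph

variable {Λ : Type v} {ar : Λ → ℕ}

/-- An edge is incident to both nodes. -/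
def Incident (G : LHypergraph.{u} ar) (x y : G.V) : Prop := ∃ e, x ∈ G.conn e ∧ y ∈ G.conn e

/-- An edge with two ends cannot join two different pairs of consecutive nodes of a path, so
distinctness of edges follows from distinctness of nodes. The shift by one converts edges into
nodes. -/
theorem forall_path_le_iff (G : LHypergraph.{u} ar) (hG : ∀ e, (G.conn e).length = 2) (n : ℕ) :
    (∀ l v e, G.IsUndirectedPath l v e → l ≤ n) ↔
      ∀ x, PathBound G.Incident (n + 1) Set.univ x := by
  constructor
  · intro h x
    by_contra hx
    obtain ⟨p, hp, -, -, ha⟩ := exists_path_of_not_pathBound (Set.mem_univ x) hx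
    choose e he using ha
    refine absurd (h (n + 1) p e ⟨hp, ?_, he⟩) (by lia)
    intro i j hij
    by_contra hne
    obtain ⟨a, b, hab⟩ := List.length_eq_two.1 (hG (e i))
    have hi := he i
    have hj := he j
    rw [← hij] at hj
    simp only [hab, List.mem_cons, List.not_mem_nil, or_false] at hi hj
    have h₁ : ∀ c d : Fin (n + 2), c.val ≠ d.val → p c ≠ p d :=
      fun c d hcd h' => hcd (congrArg Fin.val (hp h'))
    have hv : i.val ≠ j.val := fun h' => hne (Fin.ext h')
    have h₂ := h₁ i.castSucc i.succ (by simp)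
    have h₃ := h₁ j.castSucc j.succ (by simp)
    have h₄ := h₁ i.castSucc j.castSucc (by simpa using hv)
    have h₅ := h₁ i.succ j.succ (by simpa using hv)
    -- The same edge traversed in opposite directions would force `i = j + 1` and `i + 1 = j`.
    have h₆ : ¬ (p i.castSucc = p j.succ ∧ p i.succ = p j.castSucc) := by
      rintro ⟨h₆, h₇⟩
      have h₆ := congrArg Fin.val (hp h₆)
      have h₇ := congrArg Fin.val (hp h₇)
      simp only [Fin.val_castSucc, Fin.val_succ] at h₆ h₇
      lia
    grind
  · intro h l v e hp
    exact Nat.lt_succ_iff.1 ((h (v 0)).length_lt v hp.1 (fun _ => Set.mem_univ _)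
      fun i => ⟨e i, hp.2.2 i⟩)

/-! ### Induced subgraphs as embeddings. -/

/-- The injective maps `fV` and `fE` identify `G` with the subgraph of `H` induced by the range of
`fV`. -/
structure IsInduced (G H : LHypergraph.{u} ar) (fV : G.V → H.V) (fE : G.E → H.E) : Prop where
  injective_onV : Function.Injective fV
  injective_onE : Function.Injective fE
  lab_eq : ∀ e, H.lab (fE e) = G.lab e
  conn_eq : ∀ e, H.conn (fE e) = (G.conn e).map fV
  full : ∀ e, (∀ x ∈ H.conn e, x ∈ Set.range fV) → e ∈ Set.range fE

theorem IsInduced.comp {G H K : LHypergraph.{u} ar} {fV : G.V → H.V} {fE : G.E → H.E}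
    {gV : H.V → K.V} {gE : H.E → K.E} (hg : IsInduced H K gV gE) (hf : IsInduced G H fV fE) :
    IsInduced G K (gV ∘ fV) (gE ∘ fE) where
  injective_onV := hg.injective_onV.comp hf.injective_onV
  injective_onE := hg.injective_onE.comp hf.injective_onE
  lab_eq e := (hg.lab_eq _).trans (hf.lab_eq e)
  conn_eq e := by rw [Function.comp_apply, hg.conn_eq, hf.conn_eq, List.map_map]
  full e he := by
    obtain ⟨e, rfl⟩ := hg.full e fun x hx => by
      obtain ⟨y, rfl⟩ := he x hx
      exact ⟨fV y, rfl⟩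
    obtain ⟨e, rfl⟩ := hf.full e fun x hx => by
      obtain ⟨y, hy⟩ := he (gV x) (by rw [hg.conn_eq]; exact List.mem_map_of_mem hx)
      exact ⟨y, hg.injective_onV hy⟩
    exact ⟨e, rfl⟩

theorem isInduced_deleteNodes (G : LHypergraph.{u} ar) (X : Set G.V) :
    IsInduced (G.deleteNodes X) G Subtype.val Subtype.val where
  injective_onV := Subtype.val_injective
  injective_onE := Subtype.val_injective
  lab_eq _ := rfl
  conn_eq e := by simp [deleteNodes]
  full e he := ⟨⟨e, fun v hv hX => by
    obtain ⟨y, rfl⟩ := he v hv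
    exact y.2 hX⟩, rfl⟩

theorem Iso.isInduced {G H : LHypergraph.{u} ar} (i : Iso G H) : IsInduced G H i.onV i.onE where
  injective_onV := i.onV.injective
  injective_onE := i.onE.injective
  lab_eq := i.lab_eq
  conn_eq := i.conn_eq
  full e _ := i.onE.surjective e

theorem inducedSubgraph_iff {G H : LHypergraph.{u} ar} :
    InducedSubgraph G H ↔ ∃ fV fE, IsInduced G H fV fE := by
  constructor
  · rintro ⟨X, ⟨i⟩⟩
    exact ⟨_, _, (H.isInduced_deleteNodes X).comp i.isInduced⟩
  · rintro ⟨fV, fE, h⟩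
    have hmap : ∀ g : G.V → {v // v ∉ (Set.range fV)ᶜ}, (∀ x, (g x).1 = fV x) →
        ∀ l : List G.V, l.map fV = (l.map g).map Subtype.val := fun g hg l => by
      rw [List.map_map]
      exact List.map_congr_left fun x _ => (hg x).symm
    refine ⟨(Set.range fV)ᶜ, ⟨⟨Equiv.ofBijective
        (fun v => ⟨fV v, fun h' => h' (Set.mem_range_self v)⟩) ⟨?_, ?_⟩,
      Equiv.ofBijective (fun e => ⟨fE e, ?_⟩) ⟨?_, ?_⟩, ?_, ?_⟩⟩⟩
    · exact fun x y hxy => h.injective_onV (congrArg Subtype.val hxy)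
    · rintro ⟨x, hx⟩
      obtain ⟨y, rfl⟩ := not_not.1 hx
      exact ⟨y, rfl⟩
    · intro x hx
      rw [h.conn_eq] at hx
      obtain ⟨y, -, rfl⟩ := List.mem_map.1 hx
      exact fun h' => h' ⟨y, rfl⟩
    · exact fun x y hxy => h.injective_onE (congrArg Subtype.val hxy)
    · rintro ⟨e, he⟩
      obtain ⟨e, rfl⟩ := h.full e fun x hx => not_not.1 (he x hx)
      exact ⟨e, rfl⟩
    · exact h.lab_eq
    · intro e
      refine List.map_injective_iff.2 Subtype.val_injective ?_
      exact ((H.isInduced_deleteNodes _).conn_eq _).symm.trans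
        ((h.conn_eq e).trans (hmap _ (fun _ => rfl) _))

theorem InducedSubgraph.refl (G : LHypergraph.{u} ar) : InducedSubgraph G G :=
  inducedSubgraph_iff.2 ⟨id, id, Function.injective_id, Function.injective_id, fun _ => rfl,
    fun _ => (List.map_id _).symm, fun e _ => ⟨e, rfl⟩⟩

theorem InducedSubgraph.trans {G H K : LHypergraph.{u} ar} (h : InducedSubgraph G H)
    (h' : InducedSubgraph H K) : InducedSubgraph G K := by
  rw [inducedSubgraph_iff] at *
  obtain ⟨fV, fE, hf⟩ := h
  obtain ⟨gV, gE, hg⟩ := h'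
  exact ⟨_, _, hg.comp hf⟩

theorem mem_boundedDigraphs_of_inducedSubgraph {n k : ℕ} {G H : LHypergraph.{u} ar}
    (h : InducedSubgraph G H) (hH : H ∈ boundedDigraphs ar n k) : G ∈ boundedDigraphs ar n k := by
  obtain ⟨fV, fE, hf⟩ := inducedSubgraph_iff.1 h
  refine ⟨fun e => ?_, fun l v e hp => ?_, fun a x y => ?_⟩
  · rw [← hH.1 (fE e), hf.conn_eq, List.length_map]
  · refine hH.2.1 l (fV ∘ v) (fE ∘ e) ⟨hf.injective_onV.comp hp.1, hf.injective_onE.comp hp.2.1,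
      fun i => ?_⟩
    simp only [Function.comp_apply, hf.conn_eq]
    exact ⟨List.mem_map_of_mem (hp.2.2 i).1, List.mem_map_of_mem (hp.2.2 i).2⟩
  · have := H.finite_E
    refine le_trans ?_ (hH.2.2 a (fV x) (fV y))
    rw [← Set.ncard_image_of_injective _ hf.injective_onE]
    refine Set.ncard_le_ncard ?_ (Set.toFinite _)
    rintro _ ⟨e, ⟨rfl, he⟩, rfl⟩
    exact ⟨hf.lab_eq e, by rw [hf.conn_eq, he]; rfl⟩

/-- Edges may be matched class by class, a class consisting of the edges with a given label and
connection sequence. Surjectivity on each class yields inducedness. -/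
theorem inducedSubgraph_of_equiv {G H : LHypergraph.{u} ar} (f : G.V → H.V)
    (hf : Function.Injective f)
    (h : ∀ a l, Nonempty ({e // G.lab e = a ∧ G.conn e = l} ≃
      {e // H.lab e = a ∧ H.conn e = l.map f})) : InducedSubgraph G H := by
  have i : ∀ a l, {e // G.lab e = a ∧ G.conn e = l} ≃ {e // H.lab e = a ∧ H.conn e = l.map f} :=
    fun a l => Classical.choice (h a l)
  let g : G.E → H.E := fun e => (i (G.lab e) (G.conn e) ⟨e, rfl, rfl⟩).1
  have hgi : ∀ e a l (he : G.lab e = a ∧ G.conn e = l), g e = (i a l ⟨e, he⟩).1 := by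
    rintro e _ _ ⟨rfl, rfl⟩
    rfl
  have hlab : ∀ e, H.lab (g e) = G.lab e := fun e => (i _ _ ⟨e, rfl, rfl⟩).2.1
  have hconn : ∀ e, H.conn (g e) = (G.conn e).map f := fun e => (i _ _ ⟨e, rfl, rfl⟩).2.2
  refine inducedSubgraph_iff.2 ⟨f, g, hf, ?_, hlab, hconn, ?_⟩
  · intro d e hde
    have h₁ : G.lab d = G.lab e := by rw [← hlab, ← hlab, hde]
    have h₂ : G.conn d = G.conn e := List.map_injective_iff.2 hf (by rw [← hconn, ← hconn, hde])
    rw [hgi d _ _ ⟨h₁, h₂⟩, hgi e _ _ ⟨rfl, rfl⟩] at hde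
    exact congrArg Subtype.val ((i _ _).injective (Subtype.ext hde))
  · intro e he
    have : H.conn e ∈ Set.range (List.map f) := by rwa [Set.range_list_map]
    obtain ⟨l, hl⟩ := this
    obtain ⟨d, hd⟩ := (i (H.lab e) l).surjective ⟨e, rfl, hl.symm⟩
    exact ⟨d.1, by rw [hgi d.1 _ _ d.2, Subtype.coe_eta, hd]⟩

/-! ### The well-quasi-order on bounded graphs. -/

/-- The nodes of a hypergraph, with the numbers of parallel edges (cut off at `k`) as entries. -/
noncomputable def toLabelledSet (k : ℕ) (G : LHypergraph.{u} ar) :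
    LabelledSet.{u} PUnit.{v + 1} (Λ → Fin (k + 1)) where
  V := G.V
  S := Set.univ
  entry x y a := Fin.ofNat (k + 1) {e : G.E | G.lab e = a ∧ G.conn e = [x, y]}.ncard
  label _ := ⟨⟩

theorem layered_toLabelledSet {n k : ℕ} {G : LHypergraph.{u} ar}
    (hG : G ∈ boundedDigraphs ar n k) :
    Layered ((G.toLabelledSet k).Linked 0) (n + 1) (G.toLabelledSet k).S := by
  have := G.finite_V
  refine RootedBound.layered (fun _ _ h => h.symm) _ _
    (show (Set.univ : Set G.V).Finite from Set.finite_univ) fun x _ => ⟨x, trivial, .refl, ?_⟩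
  refine ((forall_path_le_iff G hG.1 n).1 hG.2.1 x).mono ?_ (fun _ h => h)
  have key : ∀ x y : G.V, (G.toLabelledSet k).entry x y ≠ 0 → G.Incident x y := by
    intro x y h
    obtain ⟨a, ha⟩ := Function.ne_iff.1 h
    have hne : {e : G.E | G.lab e = a ∧ G.conn e = [x, y]}.Nonempty := by
      by_contra hne
      rw [Set.not_nonempty_iff_eq_empty] at hne
      exact ha (by simp [toLabelledSet, hne])
    obtain ⟨e, -, he⟩ := hne
    exact ⟨e, by simp [he]⟩
  rintro x y (h | h)
  · exact key x y h
  · obtain ⟨e, he⟩ := key y x h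
    exact ⟨e, he.symm⟩

theorem inducedSubgraph_of_embeds {n k : ℕ} {G H : LHypergraph.{u} ar}
    (hG : G ∈ boundedDigraphs ar n k) (hH : H ∈ boundedDigraphs ar n k)
    (h : (G.toLabelledSet k).Embeds (H.toLabelledSet k)) : InducedSubgraph G H := by
  obtain ⟨(f : G.V → H.V), hf⟩ := h
  have hfG : Function.Injective f := Set.injOn_univ.1 hf.injOn
  refine inducedSubgraph_of_equiv f hfG fun a l => ?_
  have := G.finite_E
  have := H.finite_E
  by_cases hl : l.length = 2
  · obtain ⟨x, y, rfl⟩ := List.length_eq_two.1 hl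
    have h := congrArg Fin.val (congrFun (hf.entry_eq x trivial y trivial) a)
    have h₁ := hG.2.2 a x y
    have h₂ := hH.2.2 a (f x) (f y)
    -- Multiplicities are at most `k`, so reduction modulo `k + 1` loses nothing.
    simp only [toLabelledSet, Fin.ofNat, Nat.mod_eq_of_lt (Nat.lt_succ_of_le h₁)] at h
    erw [Nat.mod_eq_of_lt (Nat.lt_succ_of_le h₂)] at h
    exact Finite.card_eq.1 h.symm
  · have h₁ : IsEmpty {e // G.lab e = a ∧ G.conn e = l} :=
      ⟨fun e => hl (by rw [← e.2.2, hG.1])⟩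
    have h₂ : IsEmpty {e // H.lab e = a ∧ H.conn e = l.map f} :=
      ⟨fun e => hl (by rw [← hH.1 e.1, e.2.2, List.length_map])⟩
    exact ⟨Equiv.equivOfIsEmpty _ _⟩

theorem partiallyWellOrderedOn_boundedDigraphs [Finite Λ] (n k : ℕ) :
    (boundedDigraphs.{u} ar n k).PartiallyWellOrderedOn InducedSubgraph := by
  rw [Set.partiallyWellOrderedOn_iff_exists_lt]
  intro G hG
  -- A graph without nodes has no edges of length two and embeds into its successor; otherwise all
  -- carriers are nonempty.
  by_cases h : ∃ i, IsEmpty (G i).V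
  · obtain ⟨i, hi⟩ := h
    let f : (G i).V → (G (i + 1)).V := isEmptyElim
    refine ⟨i, i + 1, i.lt_succ_self, inducedSubgraph_of_equiv f
      (Function.injective_of_subsingleton _) fun a l => ?_⟩
    obtain rfl : l = [] := List.eq_nil_iff_forall_not_mem.2 fun x => isEmptyElim x
    have h₁ : IsEmpty {e // (G i).lab e = a ∧ (G i).conn e = []} :=
      ⟨fun e => by simpa [e.2.2] using (hG i).1 e.1⟩
    have h₂ : IsEmpty {e // (G (i + 1)).lab e = a ∧ (G (i + 1)).conn e = [].map f} :=
      ⟨fun e => by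
        have h := (hG (i + 1)).1 e.1
        rw [e.2.2] at h
        exact absurd h (by simp)⟩
    exact ⟨Equiv.equivOfIsEmpty _ _⟩
  · simp only [not_exists, not_isEmpty_iff] at h
    obtain ⟨i, j, hij, hle⟩ :=
      (LabelledSet.partiallyWellOrderedOn_layered (0 : Λ → Fin (k + 1)) (n + 1)
        PUnit).exists_lt (f := fun i => (G i).toLabelledSet k)
        fun i => ⟨h i, layered_toLabelledSet (hG i)⟩
    exact ⟨i, j, hij, inducedSubgraph_of_embeds (hG i) (hG j) hle⟩

end LHypergraph

/-! ### Gluing of partial functions. -/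

/-- The relation which identifies the values of the partial functions `r` and `m` at every point,
on the disjoint union of their codomains, where the second one is restricted to `s`. -/
def GlueRel {L R G : Type u} (r : L → Option R) (m : L → Option G) (s : G → Prop)
    (a b : R ⊕ {g // s g}) : Prop :=
  ∃ x y g, r x = some y ∧ m x = some g.1 ∧ a = .inl y ∧ b = .inr g

/-- The gluing of the codomains of two partial functions. -/
def Glue {L R G : Type u} (r : L → Option R) (m : L → Option G) (s : G → Prop) : Type u :=
  Quot (GlueRel r m s)

namespace Glue

variable {L R G K : Type u} {r : L → Option R} {m : L → Option G} {s : G → Prop}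

instance [Finite R] [Finite G] : Finite (Glue r m s) := Finite.of_surjective _ Quot.mk_surjective

/-- The map from the first codomain to the gluing. -/
def inl (r : L → Option R) (m : L → Option G) (s : G → Prop) (y : R) : Glue r m s :=
  Quot.mk _ (.inl y)

/-- The map from the preserved part of the second codomain to the gluing. -/
def mk (r : L → Option R) (m : L → Option G) (s : G → Prop) (g : {g // s g}) : Glue r m s :=
  Quot.mk _ (.inr g)

open Classical in
/-- The partial map from the second codomain to the gluing. -/
noncomputable def inr (r : L → Option R) (m : L → Option G) (s : G → Prop) (g : G) :
    Option (Glue r m s) :=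
  if h : s g then some (mk r m s ⟨g, h⟩) else none

theorem inr_of (g : {g // s g}) : inr r m s g.1 = some (mk r m s g) := dif_pos g.2

theorem inr_of_not {g : G} (h : ¬ s g) : inr r m s g = none := dif_neg h

theorem comm (hs : ∀ x g, m x = some g → (s g ↔ (r x).isSome)) (hm : ∀ x, (m x).isSome) (x : L) :
    (r x).map (inl r m s) = (m x).bind (inr r m s) := by
  obtain ⟨g, hg⟩ := Option.isSome_iff_exists.1 (hm x)
  rw [hg, Option.bind_some]
  cases hr : r x with
  | none =>
    rw [inr_of_not fun h => by simpa [hr] using (hs x g hg).1 h, Option.map_none]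
  | some y =>
    have h : s g := (hs x g hg).2 (by simp [hr])
    rw [inr_of ⟨g, h⟩, Option.map_some]
    exact congrArg some (Quot.sound ⟨x, y, ⟨g, h⟩, hr, hg, rfl, rfl⟩)

/-- The partial function on the gluing which is induced by a commutative square. -/
def desc (g : R → Option K) (f : G → Option K) (h : ∀ x, (r x).bind g = (m x).bind f) :
    Glue r m s → Option K :=
  Quot.lift (Sum.elim g fun v => f v.1) (by
    rintro _ _ ⟨x, y, z, hr, hm, rfl, rfl⟩
    simpa [hr, hm] using h x)

theorem inr_bind_desc {g : R → Option K} {f : G → Option K}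
    (h : ∀ x, (r x).bind g = (m x).bind f) (hf : ∀ v, ¬ s v → f v = none) (v : G) :
    (inr r m s v).bind (desc g f h) = f v := by
  by_cases hv : s v
  · rw [inr_of ⟨v, hv⟩]
    rfl
  · rw [inr_of_not hv, hf v hv, Option.bind_none]

theorem hom_ext {f g : Glue r m s → Option K} (h₁ : ∀ y, f (inl r m s y) = g (inl r m s y))
    (h₂ : ∀ v, (inr r m s v).bind f = (inr r m s v).bind g) : f = g := by
  funext q
  obtain ⟨y | v, rfl⟩ := Quot.mk_surjective q
  · exact h₁ y
  · have h := h₂ v.1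
    rw [inr_of v] at h
    exact h

end Glue

/-! ### Partial morphisms, and pushouts restricted to induced subgraphs. -/

namespace LHypergraph

variable {Λ : Type v} {ar : Λ → ℕ}

namespace Mor

variable {G H K M : LHypergraph.{u} ar}

/-- The identity morphism. -/
def id (G : LHypergraph.{u} ar) : Mor G G where
  onV := some
  onE := some
  lab_eq := by rintro e _ ⟨⟩; rfl
  conn_eq := by rintro e _ ⟨⟩; rfl

theorem comp_assoc (h : Mor K M) (g : Mor H K) (f : Mor G H) :
    (h.comp g).comp f = h.comp (g.comp f) :=
  Mor.ext (funext fun v => (Option.bind_assoc (f.onV v) g.onV h.onV).symm)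
    (funext fun e => (Option.bind_assoc (f.onE e) g.onE h.onE).symm)

theorem id_comp (f : Mor G H) : (Mor.id H).comp f = f :=
  Mor.ext (funext fun v => Option.bind_fun_some (f.onV v))
    (funext fun e => Option.bind_fun_some (f.onE e))

theorem comp_id (f : Mor G H) : f.comp (Mor.id G) = f := rfl

theorem onE_eq_none (f : Mor G H) {e : G.E} {x : G.V} (hx : x ∈ G.conn e) (h : f.onV x = none) :
    f.onE e = none := by
  by_contra he
  obtain ⟨e', he'⟩ := Option.ne_none_iff_exists'.1 he
  have h₁ : none ∈ (G.conn e).map f.onV := h ▸ List.mem_map_of_mem hx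
  rw [f.conn_eq e e' he'] at h₁
  simp at h₁

theorem inducedSubgraph_of_inverse (a : Mor G H) (b : Mor H G) (hba : b.comp a = Mor.id G)
    (hab : a.comp b = Mor.id H) : InducedSubgraph G H := by
  have hV : ∀ v, ∃ w, a.onV v = some w ∧ b.onV w = some v := fun v =>
    Option.bind_eq_some_iff.1 (congrFun (congrArg Mor.onV hba) v)
  have hE : ∀ v, ∃ w, a.onE v = some w ∧ b.onE w = some v := fun v =>
    Option.bind_eq_some_iff.1 (congrFun (congrArg Mor.onE hba) v)
  choose fV hfV hfV' using hV
  choose fE hfE hfE' using hE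
  refine inducedSubgraph_iff.2 ⟨fV, fE, fun x y h => ?_, fun x y h => ?_,
    fun e => a.lab_eq e _ (hfE e), fun e => ?_, fun e _ => ?_⟩
  · exact Option.some_injective _ (by rw [← hfV' x, ← hfV' y, h])
  · exact Option.some_injective _ (by rw [← hfE' x, ← hfE' y, h])
  · refine List.map_injective_iff.2 (Option.some_injective _) ?_
    rw [← a.conn_eq e _ (hfE e), List.map_map]
    exact List.map_congr_left fun x _ => hfV x
  · obtain ⟨d, -, hd⟩ := Option.bind_eq_some_iff.1 (congrFun (congrArg Mor.onE hab) e)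
    exact ⟨d, Option.some_injective _ (by rw [← hfE d, hd])⟩

end Mor

theorem inducedSubgraph_of_isPushout {G₀ G₁ G₂ G₃ G₃' : LHypergraph.{u} ar} {f : Mor G₀ G₁}
    {g : Mor G₀ G₂} {g₁ : Mor G₁ G₃} {f₁ : Mor G₂ G₃} {g₂ : Mor G₁ G₃'} {f₂ : Mor G₂ G₃'}
    (h : IsPushout f g g₁ f₁) (h' : IsPushout f g g₂ f₂) : InducedSubgraph G₃ G₃' := by
  obtain ⟨a, ⟨ha, ha'⟩, -⟩ := h.2 G₃' g₂ f₂ h'.1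
  obtain ⟨b, ⟨hb, hb'⟩, -⟩ := h'.2 G₃ g₁ f₁ h.1
  refine Mor.inducedSubgraph_of_inverse a b ?_ ?_
  · exact (h.2 G₃ g₁ f₁ h.1).unique
      ⟨by rw [Mor.comp_assoc, ha, hb], by rw [Mor.comp_assoc, ha', hb']⟩
      ⟨Mor.id_comp _, Mor.id_comp _⟩
  · exact (h'.2 G₃' g₂ f₂ h'.1).unique
      ⟨by rw [Mor.comp_assoc, hb, ha], by rw [Mor.comp_assoc, hb', ha']⟩
      ⟨Mor.id_comp _, Mor.id_comp _⟩

namespace IsInduced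

variable {G H : LHypergraph.{u} ar} {fV : G.V → H.V} {fE : G.E → H.E}

/-- The inclusion morphism of an induced subgraph. -/
def incl (h : IsInduced G H fV fE) : Mor G H where
  onV v := some (fV v)
  onE e := some (fE e)
  lab_eq := by rintro e _ ⟨⟩; exact h.lab_eq e
  conn_eq := by rintro e _ ⟨⟩; rw [h.conn_eq, List.map_map]; rfl

/-- The morphism which deletes the nodes outside an induced subgraph. -/
noncomputable def del (h : IsInduced G H fV fE) : Mor H G where
  onV := Function.partialInv fV
  onE := Function.partialInv fE
  lab_eq e e' he := by
    rw [← (h.injective_onE.isPartialInv _ _).1 he, h.lab_eq]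
  conn_eq e e' he := by
    rw [← (h.injective_onE.isPartialInv _ _).1 he, h.conn_eq, List.map_map]
    exact List.map_congr_left fun x _ =>
      (h.injective_onV.isPartialInv _ _).2 rfl

theorem del_onV (h : IsInduced G H fV fE) (x : G.V) : h.del.onV (fV x) = some x :=
  (h.injective_onV.isPartialInv _ _).2 rfl

theorem del_onE (h : IsInduced G H fV fE) (x : G.E) : h.del.onE (fE x) = some x :=
  (h.injective_onE.isPartialInv _ _).2 rfl

theorem del_onV_eq_none (h : IsInduced G H fV fE) {x : H.V} (hx : x ∉ Set.range fV) :
    h.del.onV x = none := dif_neg hx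

theorem del_comp_incl (h : IsInduced G H fV fE) : h.del.comp h.incl = Mor.id G :=
  Mor.ext (funext h.del_onV) (funext h.del_onE)

/-- A morphism undefined outside the subgraph factors through the deletion. On edges this uses
fullness: an edge outside the subgraph has an incident node outside it. -/
theorem comp_incl_comp_del (h : IsInduced G H fV fE) {K : LHypergraph.{u} ar} (η : Mor H K)
    (hη : ∀ x ∉ Set.range fV, η.onV x = none) : (η.comp h.incl).comp h.del = η := by
  refine Mor.ext (funext fun x => ?_) (funext fun e => ?_)
  · by_cases hx : x ∈ Set.range fV
    · obtain ⟨y, rfl⟩ := hx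
      change (h.del.onV (fV y)).bind _ = _
      rw [h.del_onV]
      rfl
    · change (h.del.onV x).bind _ = _
      rw [h.del_onV_eq_none hx, hη x hx, Option.bind_none]
  · by_cases he : e ∈ Set.range fE
    · obtain ⟨y, rfl⟩ := he
      change (h.del.onE (fE y)).bind _ = _
      rw [h.del_onE]
      rfl
    · obtain ⟨x, hxe, hx⟩ : ∃ x ∈ H.conn e, x ∉ Set.range fV := by
        by_contra! h'
        exact he (h.full e h')
      rw [Mor.onE_eq_none _ hxe (hη x hx)]
      exact Option.bind_eq_none_iff.2 fun d hd => by
        simp [Mor.onE_eq_none _ hxe (h.del_onV_eq_none hx)] at hd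

/-- A pushout over an induced subgraph is an induced subgraph of the pushout. -/
theorem exists_isPushout (h : IsInduced G H fV fE) {L R P : LHypergraph.{u} ar} {r : Mor L R}
    {m : Mor L G} {m' : Mor R P} {r' : Mor H P} (hp : IsPushout r (h.incl.comp m) m' r') :
    ∃ (X : Set P.V) (m₁ : Mor R (P.deleteNodes X)) (r₁ : Mor G (P.deleteNodes X)),
      IsPushout r m m₁ r₁ := by
  -- The images of the nodes outside the subgraph.
  set X : Set P.V := {p | ∃ v ∉ Set.range fV, r'.onV v = some p} with hX
  have hi := P.isInduced_deleteNodes X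
  have hfac : ((hi.del.comp r').comp h.incl).comp h.del = hi.del.comp r' :=
    h.comp_incl_comp_del _ fun v hv => Option.bind_eq_none_iff.2 fun p hp =>
      hi.del_onV_eq_none (by
        rintro ⟨q, rfl⟩
        exact q.2 ⟨v, hv, hp⟩)
  refine ⟨X, hi.del.comp m', (hi.del.comp r').comp h.incl, ?_, fun K g f hgf => ?_⟩
  · rw [Mor.comp_assoc, hp.1]
    simp only [Mor.comp_assoc]
  · have hμ : (f.comp h.del).comp h.incl = f := by
      rw [Mor.comp_assoc, h.del_comp_incl, Mor.comp_id]
    -- Extend the cocone to `H` by leaving it undefined outside `G`. The mediating `η` is then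
    -- undefined on `X` and factors through the deletion of `X`.
    obtain ⟨η, ⟨hη₁, hη₂⟩, huniq⟩ := hp.2 K g (f.comp h.del) (by
      rw [hgf, ← Mor.comp_assoc, hμ])
    have hη : (η.comp hi.incl).comp hi.del = η := by
      refine hi.comp_incl_comp_del η fun p hp => ?_
      have hpX : p ∈ X := by
        by_contra hpX
        exact hp ⟨⟨p, hpX⟩, rfl⟩
      obtain ⟨v, hv, hvp⟩ := hpX
      have h₁ := congrFun (congrArg Mor.onV hη₂) v
      change (r'.onV v).bind _ = (h.del.onV v).bind _ at h₁
      rwa [hvp, h.del_onV_eq_none hv] at h₁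
    refine ⟨η.comp hi.incl, ⟨?_, ?_⟩, fun θ hθ => ?_⟩
    · rw [← Mor.comp_assoc, hη, hη₁]
    · rw [← Mor.comp_assoc, ← Mor.comp_assoc, hη, hη₂, hμ]
    · have : θ.comp hi.del = η := huniq _ ⟨by rw [Mor.comp_assoc, hθ.1], by
        rw [Mor.comp_assoc, ← hfac, ← Mor.comp_assoc, hθ.2]⟩
      rw [← this, Mor.comp_assoc, hi.del_comp_incl, Mor.comp_id]

end IsInduced

/-! ### Explicit pushouts along conflict-free matches, and compatibility. -/

section Pushout

variable {L R G : LHypergraph.{u} ar} (r : Mor L R) (m : Mor L G)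

/-- A node is preserved if `r` is defined on all its preimages under `m`. -/
def PreservedV (v : G.V) : Prop := ∀ x, m.onV x = some v → (r.onV x).isSome

/-- An edge is preserved if `r` is defined on all its preimages under `m` and all nodes incident to
it are preserved. -/
def PreservedE (e : G.E) : Prop :=
  (∀ x, m.onE x = some e → (r.onE x).isSome) ∧ ∀ v ∈ G.conn e, PreservedV r m v

variable {r m}

theorem preservedV_iff (hc : ConflictFree r m) (x : L.V) (v : G.V) (h : m.onV x = some v) :
    PreservedV r m v ↔ (r.onV x).isSome :=
  ⟨fun h' => h' x h, fun h' y hy => (hc.1 y x (hy.trans h.symm)).2 h'⟩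

/-- If `r` is defined on a matched edge, it is defined on the incident nodes, which
conflict-freeness makes preserved. -/
theorem preservedE_iff (hc : ConflictFree r m) (x : L.E) (e : G.E)
    (h : m.onE x = some e) : PreservedE r m e ↔ (r.onE x).isSome := by
  refine ⟨fun h' => h'.1 x h, fun h' => ⟨fun y hy => (hc.2 y x (hy.trans h.symm)).2 h', ?_⟩⟩
  intro v hv
  have h₁ : some v ∈ (L.conn x).map m.onV := by
    rw [m.conn_eq x e h]
    exact List.mem_map_of_mem hv
  obtain ⟨y, hy, hyv⟩ := List.mem_map.1 h₁
  rw [preservedV_iff hc y v hyv]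
  by_contra hn
  rw [r.onE_eq_none hy (Option.not_isSome_iff_eq_none.1 hn)] at h'
  simp at h'

variable (r m)

/-- The connection sequence of a preserved edge in the gluing. -/
def preservedConn (e : {e // PreservedE r m e}) : List (Glue r.onV m.onV (PreservedV r m)) :=
  ((G.conn e.1).attachWith _ e.2.2).map (Glue.mk _ _ _)

variable {r m}

theorem map_some_preservedConn (e : {e // PreservedE r m e}) :
    (preservedConn r m e).map some = (G.conn e.1).map (Glue.inr _ _ _) := by
  rw [preservedConn, List.map_map]
  conv_rhs => rw [← List.attachWith_map_subtype_val (l := G.conn e.1) e.2.2, List.map_map]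
  exact List.map_congr_left fun v _ => (Glue.inr_of v).symm

/-- The gluing of `R` and `G` along `L`, without the elements of `G` that are not preserved. -/
def pushoutObj (hm : m.IsTotal) (hc : ConflictFree r m) : LHypergraph.{u} ar where
  V := Glue r.onV m.onV (PreservedV r m)
  E := Glue r.onE m.onE (PreservedE r m)
  finite_V := by
    have := R.finite_V
    have := G.finite_V
    infer_instance
  finite_E := by
    have := R.finite_E
    have := G.finite_E
    infer_instance
  conn := Quot.lift (Sum.elim (fun e => (R.conn e).map (Glue.inl _ _ _)) (preservedConn r m)) (by
    rintro _ _ ⟨x, y, e, hr, he, rfl, rfl⟩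
    refine List.map_injective_iff.2 (Option.some_injective _) ?_
    have h₁ := congrArg (List.map (Option.map (Glue.inl r.onV m.onV (PreservedV r m))))
      (r.conn_eq x y hr)
    have h₂ := congrArg (List.map fun o => o.bind (Glue.inr r.onV m.onV (PreservedV r m)))
      (m.conn_eq x e he)
    rw [List.map_map, List.map_map] at h₁ h₂
    rw [Sum.elim_inl, Sum.elim_inr, map_some_preservedConn, List.map_map]
    refine h₁.symm.trans (Eq.trans ?_ h₂)
    exact List.map_congr_left fun z _ => Glue.comm (preservedV_iff hc) hm.1 z)
  lab := Quot.lift (Sum.elim R.lab fun e => G.lab e.1) (by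
    rintro _ _ ⟨x, y, e, hr, he, rfl, rfl⟩
    exact (r.lab_eq x y hr).trans (m.lab_eq x e he).symm)
  length_conn := by
    rintro ⟨e | e⟩
    · exact (List.length_map _).trans (R.length_conn e)
    · refine Eq.trans ?_ (G.length_conn e.1)
      exact (List.length_map _).trans List.length_attachWith

/-- The morphism from the right-hand side to the gluing. -/
def pushoutInl (hm : m.IsTotal) (hc : ConflictFree r m) : Mor R (pushoutObj hm hc) where
  onV v := some (Glue.inl _ _ _ v)
  onE e := some (Glue.inl _ _ _ e)
  lab_eq := by rintro e _ ⟨⟩; rfl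
  conn_eq := by rintro e _ ⟨⟩; exact List.map_map.symm

/-- The morphism from the rewritten hypergraph to the gluing. -/
noncomputable def pushoutInr (hm : m.IsTotal) (hc : ConflictFree r m) :
    Mor G (pushoutObj hm hc) where
  onV := Glue.inr _ _ _
  onE := Glue.inr _ _ _
  lab_eq e e' h := by
    by_cases he : PreservedE r m e
    · rw [Glue.inr_of ⟨e, he⟩] at h
      cases h
      rfl
    · rw [Glue.inr_of_not he] at h
      cases h
  conn_eq e e' h := by
    by_cases he : PreservedE r m e
    · rw [Glue.inr_of ⟨e, he⟩] at h
      cases h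
      exact (map_some_preservedConn ⟨e, he⟩).symm
    · rw [Glue.inr_of_not he] at h
      cases h

/-- Commutativity forces every competing morphism on `G` to be undefined on unpreserved elements, so
it descends to the gluing. -/
theorem isPushout_pushoutObj (hm : m.IsTotal) (hc : ConflictFree r m) :
    IsPushout r m (pushoutInl hm hc) (pushoutInr hm hc) := by
  refine ⟨Mor.ext (funext fun x => ?_) (funext fun x => ?_), fun K g f h => ?_⟩
  · exact (Option.map_eq_bind).symm.trans (Glue.comm (preservedV_iff hc) hm.1 x)
  · exact (Option.map_eq_bind).symm.trans (Glue.comm (preservedE_iff hc) hm.2 x)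
  have hV : ∀ x, (r.onV x).bind g.onV = (m.onV x).bind f.onV := congrFun (congrArg Mor.onV h)
  have hE : ∀ x, (r.onE x).bind g.onE = (m.onE x).bind f.onE := congrFun (congrArg Mor.onE h)
  have hfV : ∀ v, ¬ PreservedV r m v → f.onV v = none := by
    intro v hv
    simp only [PreservedV, not_forall, Option.not_isSome_iff_eq_none] at hv
    obtain ⟨x, hx, hr⟩ := hv
    simpa [hr, hx] using (hV x).symm
  have hfE : ∀ e, ¬ PreservedE r m e → f.onE e = none := by
    intro e he
    rw [PreservedE, not_and_or] at he
    rcases he with he | he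
    · simp only [not_forall, Option.not_isSome_iff_eq_none] at he
      obtain ⟨x, hx, hr⟩ := he
      simpa [hr, hx] using (hE x).symm
    · push Not at he
      obtain ⟨v, hv, hn⟩ := he
      exact f.onE_eq_none hv (hfV v hn)
  let η : Mor (pushoutObj hm hc) K :=
    { onV := Glue.desc g.onV f.onV hV
      onE := Glue.desc g.onE f.onE hE
      lab_eq := by
        rintro ⟨e | e⟩ e' he
        · exact g.lab_eq e e' he
        · exact f.lab_eq e.1 e' he
      conn_eq := by
        rintro ⟨e | e⟩ e' he
        · exact List.map_map.trans (g.conn_eq e e' he)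
        · refine Eq.trans ?_ (f.conn_eq e.1 e' he)
          have h₁ := congrArg (List.map fun o => o.bind (Glue.desc g.onV f.onV hV))
            (map_some_preservedConn e)
          rw [List.map_map, List.map_map] at h₁
          refine h₁.trans (List.map_congr_left fun v _ => ?_)
          exact Glue.inr_bind_desc hV hfV v }
  refine ⟨η, ⟨rfl, ?_⟩, ?_⟩
  · exact Mor.ext (funext fun v => Glue.inr_bind_desc hV hfV v)
      (funext fun e => Glue.inr_bind_desc hE hfE e)
  · rintro θ ⟨h₁, h₂⟩
    refine Mor.ext (Glue.hom_ext ?_ ?_) (Glue.hom_ext ?_ ?_)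
    · exact congrFun (congrArg Mor.onV h₁)
    · exact fun v => (congrFun (congrArg Mor.onV h₂) v).trans (Glue.inr_bind_desc hV hfV v).symm
    · exact congrFun (congrArg Mor.onE h₁)
    · exact fun v => (congrFun (congrArg Mor.onE h₂) v).trans (Glue.inr_bind_desc hE hfE v).symm

end Pushout

theorem Rule.Rewrites.exists_of_inducedSubgraph {ρ : Rule.{u} ar} {G H G' : LHypergraph.{u} ar}
    (h : ρ.Rewrites G H) (hG : InducedSubgraph G G') :
    ∃ H', ρ.Rewrites G' H' ∧ InducedSubgraph H H' := by
  obtain ⟨m, hm, hc, m₁, r₁, hp⟩ := h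
  obtain ⟨fV, fE, hf⟩ := inducedSubgraph_iff.1 hG
  have hm' : (hf.incl.comp m).IsTotal :=
    ⟨fun x => by
      obtain ⟨y, hy⟩ := Option.isSome_iff_exists.1 (hm.1 x)
      simp [Mor.comp, hy, IsInduced.incl],
      fun x => by
      obtain ⟨y, hy⟩ := Option.isSome_iff_exists.1 (hm.2 x)
      simp [Mor.comp, hy, IsInduced.incl]⟩
  have hm₂ : hf.del.comp (hf.incl.comp m) = m := by
    rw [← Mor.comp_assoc, hf.del_comp_incl, Mor.id_comp]
  have hc' : ConflictFree ρ.r (hf.incl.comp m) := by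
    refine ⟨fun x y hxy => hc.1 x y ?_, fun x y hxy => hc.2 x y ?_⟩
    · rw [← hm₂]
      exact congrArg (fun o => o.bind hf.del.onV) hxy
    · rw [← hm₂]
      exact congrArg (fun o => o.bind hf.del.onE) hxy
  have hp' := isPushout_pushoutObj hm' hc'
  obtain ⟨X, m₂, r₂, hp₂⟩ := hf.exists_isPushout hp'
  exact ⟨_, ⟨_, hm', hc', _, _, hp'⟩, (inducedSubgraph_of_isPushout hp hp₂).trans
    (inducedSubgraph_iff.2 ⟨_, _, isInduced_deleteNodes _ X⟩)⟩

end LHypergraph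

/-! ### Decidability of membership. -/

theorem PathBound.equiv_iff {V : Type u} {W : Type v} (f : V → W) (hf : Function.Injective f)
    {adj : V → V → Prop} {adj' : W → W → Prop} (h : ∀ x y, adj' (f x) (f y) ↔ adj x y)
    (h' : ∀ x z, adj' (f x) z → z ∈ Set.range f) :
    ∀ (m : ℕ) (S : Set V) (S' : Set W), f ⁻¹' S' = S → ∀ x,
      (PathBound adj' m S' (f x) ↔ PathBound adj m S x)
  | 0, _, _, _, _ => Iff.rfl
  | m + 1, S, S', hS, x => by
    have hS' : f ⁻¹' (S' \ {f x}) = S \ {x} := by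
      ext y
      simp [← hS, hf.eq_iff]
    have ih := PathBound.equiv_iff f hf h h' m _ _ hS'
    constructor
    · intro hb y hy hne hxy
      exact (ih y).1 (hb (f y) (by rwa [← hS] at hy) (hf.ne hne) ((h x y).2 hxy))
    · intro hb z hz hne hxz
      obtain ⟨y, rfl⟩ := h' x z hxz
      exact (ih y).2 (hb y (by rwa [← hS]) (fun h => hne (h ▸ rfl)) ((h x y).1 hxz))

/-- Every path in the described hypergraph which starts at `x` and avoids the nodes in `vis` has at
most `m` nodes. -/
def CodePathBound (L : List (List ℕ × ℕ)) : ℕ → List ℕ → ℕ → Prop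
  | 0, _, _ => False
  | m + 1, vis, x => ∀ e ∈ L, ∀ y ∈ e.1, x ∉ e.1 ∨ y ∈ x :: vis ∨ CodePathBound L m (x :: vis) y

theorem codePathBound_iff (L : List (List ℕ × ℕ)) : ∀ (m : ℕ) (vis : List ℕ) (x : ℕ),
    CodePathBound L m vis x ↔
      PathBound (fun x y => ∃ e ∈ L, x ∈ e.1 ∧ y ∈ e.1) m {y | y ∉ vis} x
  | 0, _, _ => Iff.rfl
  | m + 1, vis, x => by
    have hS : {y | y ∉ vis} \ {x} = {y | y ∉ x :: vis} := by
      ext y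
      simp [and_comm]
    simp only [CodePathBound, PathBound, hS, codePathBound_iff L m]
    simp only [List.mem_cons, Set.mem_ofPred_eq]
    constructor
    · rintro h y hy hne ⟨e, he, hx, hye⟩
      have := h e he y hye
      tauto
    · intro h e he y hye
      by_cases hx : x ∈ e.1 <;> by_cases hy : y ∈ vis <;> by_cases hne : y = x <;>
        simp only [hx, hy, hne, not_true_eq_false, not_false_eq_true, true_or, or_true,
          false_or, or_false]
      exact h y hy hne ⟨e, he, hx, hye⟩

theorem PrimrecPred.forall_mem {α β : Type*} [Primcodable α] [Primcodable β] {R : α → β → Prop}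
    {f : α → List β} (hf : Primrec f) (hR : PrimrecRel R) :
    PrimrecPred fun a => ∀ b ∈ f a, R a b :=
  (PrimrecRel.forall_mem_list hR.swap).comp hf Primrec.id

theorem primrecPred_mem {α β : Type*} [Primcodable α] [Primcodable β] {f : α → List β} {g : α → β}
    (hf : Primrec f) (hg : Primrec g) : PrimrecPred fun a => g a ∈ f a :=
  ((PrimrecRel.exists_mem_list (Primrec.eq (α := β))).comp hf hg).of_eq fun a => by simp

/-- The bound `m` is fixed outside the predicate, so each round adds just two quantifiers over
lists. -/
theorem primrecPred_codePathBound (m : ℕ) :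
    PrimrecPred fun p : List (List ℕ × ℕ) × List ℕ × ℕ => CodePathBound p.1 m p.2.1 p.2.2 := by
  induction m with
  | zero => exact ⟨fun _ => isFalse id, (Primrec.const false).of_eq fun _ => rfl⟩
  | succ m ih =>
    refine PrimrecPred.forall_mem Primrec.fst ?_
    refine PrimrecPred.forall_mem (α := (List (List ℕ × ℕ) × List ℕ × ℕ) × List ℕ × ℕ)
      (f := fun q => q.2.1) (Primrec.fst.comp Primrec.snd) ?_
    have hL : Primrec fun q : ((List (List ℕ × ℕ) × List ℕ × ℕ) × List ℕ × ℕ) × ℕ => q.1.1.1 :=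
      Primrec.fst.comp (Primrec.fst.comp Primrec.fst)
    have hvis : Primrec fun q : ((List (List ℕ × ℕ) × List ℕ × ℕ) × List ℕ × ℕ) × ℕ => q.1.1.2.1 :=
      Primrec.fst.comp (Primrec.snd.comp (Primrec.fst.comp Primrec.fst))
    have hx : Primrec fun q : ((List (List ℕ × ℕ) × List ℕ × ℕ) × List ℕ × ℕ) × ℕ => q.1.1.2.2 :=
      Primrec.snd.comp (Primrec.snd.comp (Primrec.fst.comp Primrec.fst))
    have he : Primrec fun q : ((List (List ℕ × ℕ) × List ℕ × ℕ) × List ℕ × ℕ) × ℕ => q.1.2.1 :=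
      Primrec.fst.comp (Primrec.snd.comp Primrec.fst)
    have hcons := Primrec.list_cons.comp hx hvis
    exact (primrecPred_mem he hx).not.or ((primrecPred_mem hcons Primrec.snd).or
      (ih.comp (hL.pair (hcons.pair Primrec.snd))))

/-- The property of descriptions which corresponds to membership in `boundedDigraphs`. -/
def CodeBounded (n k : ℕ) (c : LHypergraph.Code) : Prop :=
  (∀ e ∈ c.2, e.1.length = 2) ∧ (∀ e ∈ c.2, ∀ x ∈ e.1, CodePathBound c.2 (n + 1) [] x) ∧
    ∀ e ∈ c.2, (c.2.filter fun d => d = e).length ≤ k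

theorem computablePred_codeBounded (n k : ℕ) : ComputablePred (CodeBounded n k) := by
  have h : PrimrecPred (CodeBounded n k) := by
    refine .and ?_ (.and ?_ ?_)
    · exact PrimrecPred.forall_mem (α := LHypergraph.Code) Primrec.snd
        (Primrec.eq.comp (Primrec.list_length.comp (Primrec.fst.comp Primrec.snd))
          (Primrec.const 2))
    · refine PrimrecPred.forall_mem (α := LHypergraph.Code) Primrec.snd ?_
      refine PrimrecPred.forall_mem (α := LHypergraph.Code × List ℕ × ℕ) (f := fun q => q.2.1)
        (Primrec.fst.comp Primrec.snd) ?_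
      exact (primrecPred_codePathBound (n + 1)).comp
        ((Primrec.snd.comp (Primrec.fst.comp Primrec.fst)).pair
          ((Primrec.const []).pair Primrec.snd))
    · refine PrimrecPred.forall_mem (α := LHypergraph.Code) Primrec.snd ?_
      exact Primrec.nat_le.comp (Primrec.list_length.comp
        ((PrimrecRel.listFilter (Primrec.eq (α := List ℕ × ℕ))).comp
          (Primrec.snd.comp Primrec.fst) Primrec.snd)) (Primrec.const k)
  obtain ⟨hd, hp⟩ := h
  exact ⟨hd, hp.to_comp⟩

theorem ncard_get_eq {α : Type*} [DecidableEq α] (l : List α) (a : α) :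
    {i : Fin l.length | l.get i = a}.ncard = (l.filter fun b => b = a).length := by
  have h := Fin.card_filter_univ_eq_vector_get_eq_count a (⟨l, rfl⟩ : List.Vector α l.length)
  rw [Set.ncard_eq_toFinset_card', Set.toFinset_ofPred]
  refine h.trans ?_
  rw [List.count_eq_length_filter]
  exact congrArg List.length (List.filter_congr fun b _ => rfl)

namespace LHypergraph

variable {Λ : Type v} {ar : Λ → ℕ}

theorem exists_encodes (ν : Λ → ℕ) (G : LHypergraph.{u} ar) : ∃ c, Encodes ν c G := by
  have := G.finite_V
  have := G.finite_E
  let f := Finite.equivFin G.V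
  let g := Finite.equivFin G.E
  let F : G.E → List ℕ × ℕ := fun e => ((G.conn e).map fun x => (f x : ℕ), ν (G.lab e))
  refine ⟨(Nat.card G.V, List.ofFn (F ∘ g.symm)), f, g.trans (finCongr (by simp)), fun e => ?_⟩
  simp [F]

/-- Testing only the listed edges suffices: isolated nodes start only trivial paths, and absent
edges have multiplicity zero. -/
theorem Encodes.codeBounded_iff {ν : Λ → ℕ} (hν : Function.Injective ν) {n k : ℕ} {c : Code}
    {G : LHypergraph.{u} ar} (h : Encodes ν c G) :
    CodeBounded n k c ↔ G ∈ boundedDigraphs ar n k := by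
  obtain ⟨f, g, hfg⟩ := h
  have := G.finite_E
  have hfi : Function.Injective fun x : G.V => (f x : ℕ) := Fin.val_injective.comp f.injective
  have hmem : ∀ d, d ∈ c.2 ↔ ∃ e, d = ((G.conn e).map fun x => (f x : ℕ), ν (G.lab e)) := by
    intro d
    rw [List.mem_iff_get]
    constructor
    · rintro ⟨i, rfl⟩
      exact ⟨g.symm i, by rw [← hfg, g.apply_symm_apply]⟩
    · rintro ⟨e, rfl⟩
      exact ⟨g e, hfg e⟩
  have hlen : (∀ e ∈ c.2, e.1.length = 2) ↔ ∀ e, (G.conn e).length = 2 := by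
    simp [hmem]
  rw [CodeBounded, hlen]
  refine and_congr_right fun h2 => ?_
  rw [forall_path_le_iff G h2]
  refine and_congr ?_ ?_
  · have key : ∀ x, CodePathBound c.2 (n + 1) [] (f x : ℕ) ↔
        PathBound G.Incident (n + 1) Set.univ x := by
      intro x
      rw [codePathBound_iff]
      refine PathBound.equiv_iff (fun x : G.V => (f x : ℕ)) hfi (fun x y => ?_)
        (fun x z => ?_) _ _ _ (by simp) x
      · constructor
        · rintro ⟨d, hd, hx, hy⟩
          obtain ⟨e, rfl⟩ := (hmem d).1 hd
          exact ⟨e, (List.mem_map_of_injective hfi).1 hx, (List.mem_map_of_injective hfi).1 hy⟩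
        · rintro ⟨e, hx, hy⟩
          exact ⟨_, (hmem _).2 ⟨e, rfl⟩, List.mem_map_of_mem hx, List.mem_map_of_mem hy⟩
      · rintro ⟨d, hd, hx, hz⟩
        obtain ⟨e, rfl⟩ := (hmem d).1 hd
        obtain ⟨y, -, rfl⟩ := List.mem_map.1 hz
        exact ⟨y, rfl⟩
    constructor
    -- Unfolding the bound once supplies a neighbour of `x`, hence an edge listing `x`.
    · intro h x y _ _ hxy
      have hxy' := hxy
      obtain ⟨e, hx, -⟩ := hxy
      exact (key x).1 (h _ ((hmem _).2 ⟨e, rfl⟩) _ (List.mem_map_of_mem hx)) y trivial ‹_› hxy'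
    · intro h d hd z hz
      obtain ⟨e, rfl⟩ := (hmem d).1 hd
      obtain ⟨y, -, rfl⟩ := List.mem_map.1 hz
      exact (key y).2 (h y)
  · have key : ∀ (a : Λ) (l : List G.V), {e : G.E | G.lab e = a ∧ G.conn e = l}.ncard =
        (c.2.filter fun d => d = (l.map fun x => (f x : ℕ), ν a)).length := by
      intro a l
      rw [← ncard_get_eq, ← Set.ncard_image_of_injective _ g.injective]
      congr 1
      ext i
      obtain ⟨e, rfl⟩ := g.surjective i
      simp only [Set.mem_image_equiv, g.symm_apply_apply, Set.mem_ofPred_eq, hfg, Prod.mk.injEq,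
        (List.map_injective_iff.2 hfi).eq_iff, hν.eq_iff, and_comm]
    constructor
    · intro h a x y
      rcases Set.eq_empty_or_nonempty {e : G.E | G.lab e = a ∧ G.conn e = [x, y]} with h0 | h0
      · simp [h0]
      · obtain ⟨e, rfl, he⟩ := h0
        rw [key, ← he]
        exact h _ ((hmem _).2 ⟨e, rfl⟩)
    · intro h d hd
      obtain ⟨e, rfl⟩ := (hmem d).1 hd
      obtain ⟨x, y, hxy⟩ := List.length_eq_two.1 (h2 e)
      rw [← key, hxy]
      exact h _ x y

end LHypergraph

theorem mainTheorem6 {Λ : Type v} [Finite Λ] (ar : Λ → ℕ) (ν : Λ → ℕ)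
    (hν : Function.Injective ν) (n k : ℕ) (T : LHypergraph.GTS.{u} ar) :
    IsRestrictedWSTS (LHypergraph.Encodes ν) (LHypergraph.boundedDigraphs.{u} ar n k)
      T.Step LHypergraph.InducedSubgraph where
  downward_closed _ _ h ht := LHypergraph.mem_boundedDigraphs_of_inducedSubgraph h ht
  decidable_mem := ⟨LHypergraph.exists_encodes ν, CodeBounded n k, computablePred_codeBounded n k,
    fun _ _ h => h.codeBounded_iff hν⟩
  le_refl := LHypergraph.InducedSubgraph.refl
  le_trans _ _ _ h h' := h.trans h'
  wqo := LHypergraph.partiallyWellOrderedOn_boundedDigraphs n k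
  compatible s₁ t₁ s₂ hle := by
    rintro ⟨ρ, hρ, h⟩
    obtain ⟨t₂, ht, hle'⟩ := h.exists_of_inducedSubgraph hle
    exact ⟨t₂, .single ⟨ρ, hρ, ht⟩, hle'⟩
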